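/- Consider non-atomic congestion games on parallel networks: finitely many parallel edges $e$ join one origin to one destination, edge $e$ has latency $\ell_e(f)=a_ef+b_e$ with $a_e,b_e\ge 0$, and the users form a closed interval $N$ whose Lebesgue measure is the mass of traffic. Let $\mathcal G^{\rm pa}$ be the class of all such games in which every edge has positive traffic in an untolled Nash flow. Let $0<S_L\le S_U$ be normalized so that $S_LS_U=1$, and let $\mathcal S$ be the set of sensitivity distributions $s:N\to[S_L,S_U]$. An affine mechanism $T$ assigns to every edge with latency $af+b$ the incentive $\tau(f)=k_1af+k_2b$, with constants $k_1,k_2$ that do not depend on the edge or on the game. User $x$ on edge $e$ has cost $\ell_e(f_e)+s_x\tau_e(f_e)$, and a flow is a Nash flow if it is induced by a choice of edges in which every user is on an edge of least cost to that user. With $\mathcal L(f)=\sum_e f_e\ell_e(f_e)$, let $$\mathrm{PoA}(T)=\sup_{G\in\mathcal G^{\rm pa}}\ \sup_{s\in\mathcal S}\ \frac{\max\{\mathcal L(f): f\text{ is a Nash flow of }(G,s,T)\}}{\min\{\mathcal L(f): f\text{ is a feasible flow of }G\}}.$$ For $\beta>0$, a toll with bound $\beta$ is an affine mechanism with $0\le\tau(f)\le\beta\ell(f)$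 for all $f\ge 0$ on every edge, and a subsidy with bound $\beta$ is an affine mechanism with $-\beta\ell(f)\le\tau(f)\le 0$ for all $f\ge 0$ on every edge. Then for every $\beta>0$ there are a toll $T^{\rm opt+}(\beta)$ and a subsidy $T^{\rm opt-}(\beta)$ that minimize $\mathrm{PoA}$ among the tolls, respectively among the subsidies, with bound $\beta$; and with $\beta^*=1/S_U=S_L$, any such minimizers satisfy: 1. if $\beta=\beta^*$, then $\mathrm{PoA}(T^{\rm opt-}(\beta))=\mathrm{PoA}(T^{\rm opt+}(\beta))$; 2. if $0<\beta<\beta^*$, then $\mathrm{PoA}(T^{\rm opt-}(\beta))<\mathrm{PoA}(T^{\rm opt+}(\beta))$; 3. if $\beta>\beta^*$, then $\mathrm{PoA}(T^{\rm opt+}(\beta))\le\mathrm{PoA}(T^{\rm opt-}(\beta))$, with strict inequality if $S_L<S_U$. -/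

import Mathlib

open MeasureTheory
open scoped ENNReal NNReal

/-- An affine latency function `f ↦ a f + b` with `a, b ≥ 0`. -/
structure AffineLatency where
  a : ℝ≥0
  b : ℝ≥0

/-- The latency observed on an edge carrying a mass `f` of traffic. -/
noncomputable def AffineLatency.eval (l : AffineLatency) (f : ℝ) : ℝ :=
  l.a * f + l.b

/-- A routing problem on a parallel network: one origin, one destination, `n` parallel edges
between them with affine latencies, and a mass `demand` of traffic. A path is a single edge. -/
structure ParallelGame where
  n : ℕ
  latency : Fin n → AffineLatency
  demand : ℝ≥0

/-- A network-agnostic incentive mechanism: it assigns to every edge an incentive function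
`f ↦ τ(f)` that depends on the latency function of the edge only. -/
abbrev Mechanism : Type := AffineLatency → ℝ → ℝ

namespace ParallelGame

/-- A flow is described by the mass of traffic on every edge. -/
abbrev Flow (G : ParallelGame) : Type := Fin G.n → ℝ

/-- The feasible flows: nonnegative, and routing the whole demand. -/
def feasible (G : ParallelGame) : Set G.Flow :=
  {f | (∀ e, 0 ≤ f e) ∧ ∑ e, f e = G.demand}

/-- The total latency `∑ f_e ℓ_e(f_e)` of a flow. -/
noncomputable def totalLatency (G : ParallelGame) (f : G.Flow) : ℝ :=
  ∑ e, f e * (G.latency e).eval (f e)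

/-- The total latency of an optimal flow. -/
noncomputable def optLatency (G : ParallelGame) : ℝ≥0∞ :=
  ⨅ f ∈ G.feasible, ENNReal.ofReal (G.totalLatency f)

/-- The non-atomic users: a closed interval whose Lebesgue measure is the demand. -/
abbrev Users (G : ParallelGame) : Type := Set.Icc (0 : ℝ) (G.demand : ℝ)

/-- The cost on edge `e`, in the flow `f` and under the mechanism `T`, of a user whose
sensitivity to incentives is `σ`. -/
noncomputable def cost (G : ParallelGame) (T : Mechanism) (f : G.Flow) (σ : ℝ)
    (e : Fin G.n) : ℝ :=
  (G.latency e).eval (f e) + σ * T (G.latency e) (f e)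

/-- `f` is a Nash flow for the sensitivity distribution `s` and the mechanism `T`: it is induced
by a (measurable) choice of an edge by every user such that no user has a cheaper edge. -/
def IsNash (G : ParallelGame) (s : G.Users → ℝ) (T : Mechanism) (f : G.Flow) : Prop :=
  ∃ P : G.Users → Fin G.n, Measurable P ∧
    (∀ e, f e = (volume : Measure ℝ).real (Subtype.val '' {x : G.Users | P x = e})) ∧
    ∀ x e, G.cost T f (s x) (P x) ≤ G.cost T f (s x) e

/-- The highest total latency of a Nash flow. -/
noncomputable def nashLatency (G : ParallelGame) (s : G.Users → ℝ) (T : Mechanism) : ℝ≥0∞ :=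
  ⨆ f : G.Flow, ⨆ _ : G.IsNash s T f, ENNReal.ofReal (G.totalLatency f)

/-- Every edge has positive traffic in an untolled Nash flow. -/
def FullyUtilized (G : ParallelGame) : Prop :=
  ∃ f : G.Flow, G.IsNash (fun _ => 1) (fun _ _ => 0) f ∧ ∀ e, 0 < f e

end ParallelGame

/-- The heterogeneous price of anarchy of a mechanism over all fully utilized parallel affine
congestion games and all sensitivity distributions with values in `[SL, SU]`. -/
noncomputable def priceOfAnarchy (SL SU : ℝ) (T : Mechanism) : ℝ≥0∞ :=
  ⨆ G : ParallelGame, ⨆ _ : G.FullyUtilized,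
    ⨆ s : G.Users → ℝ, ⨆ _ : ∀ x, s x ∈ Set.Icc SL SU,
      G.nashLatency s T / G.optLatency

/-- The affine mechanism that assigns `k₁ a f + k₂ b` to an edge with latency `a f + b`. -/
noncomputable def affineMechanism (k₁ k₂ : ℝ) : Mechanism :=
  fun l f => k₁ * (l.a * f) + k₂ * l.b

/-- The affine tolling mechanisms with incentive bound `β`: tolls lie in `[0, β ℓ(f)]`. -/
def affineTolls (β : ℝ) : Set Mechanism :=
  {T | (∃ k₁ k₂, T = affineMechanism k₁ k₂) ∧
    ∀ (l : AffineLatency) (f : ℝ), 0 ≤ f → T l f ∈ Set.Icc 0 (β * l.eval f)}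

/-- The affine subsidy mechanisms with incentive bound `β`: subsidies lie in `[-β ℓ(f), 0]`. -/
def affineSubsidies (β : ℝ) : Set Mechanism :=
  {T | (∃ k₁ k₂, T = affineMechanism k₁ k₂) ∧
    ∀ (l : AffineLatency) (f : ℝ), 0 ≤ f → T l f ∈ Set.Icc (-(β * l.eval f)) 0}

/-- `T` minimizes the heterogeneous price of anarchy over the set `M` of mechanisms. -/
def IsOptimalMechanism (SL SU : ℝ) (M : Set Mechanism) (T : Mechanism) : Prop :=
  T ∈ M ∧ ∀ T' ∈ M, priceOfAnarchy SL SU T ≤ priceOfAnarchy SL SU T'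

/-! Under `affineMechanism k₁ k₂` a user of sensitivity `σ` weighs the terms of a latency by `1 + σ
k₁` and `1 + σ k₂`. Where `1 + σ k₁ > 0` only the ratio `r = (1 + σ k₂) / (1 + σ k₁)` matters: the
user minimizes `a f + r b`. Marginal-cost pricing is `r = 1/2`, so the quality of a mechanism is its
distortion `E`, the largest `|2 r - 1|` over the sensitivities. If `E < 1`, the price of anarchy is
exactly `1 + E² / 3`.

Upper bound (`sum_latency_le_of_weighted_equilibrium`): let `p` equalize the marginal latencies. The
total latency of any flow is that of `p` plus the quadratic form `∑ a (f - p)²`. Passing from the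
untolled Nash flow `h` to the incentivized one contracts `a (f - p)` by the factor `E`, and `h`
costs at most `4/3` of `p`. Lower bound (`le_priceOfAnarchy_affineMechanism`): Pigou's network
attains the ratio in a limit.

It remains to minimize `E`. For small `β` the least sensitive users respond too weakly and alone
determine `E`. For larger `β` the spread between `SL` and `SU` is the obstacle: no choice of `k₂`
beats `(SU - SL) / (SU + SL + 2 k₁)` (`le_priceOfAnarchy_of_spread`). Tolls lower this bound by
taking `k₁ = β`, whereas subsidies can do no better than `k₁ = 0`. The two resulting distortions
cross at `β = SL`. -/

/-! ### Quadratic estimates for weighted equilibria -/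

section Analysis

/-- The two best-response inequalities between `i` and `j` bound the difference from both sides;
replacing `r` by `1/2` leaves an error `(2 r - 1) (b i / 2 - b j / 2)`. -/
theorem abs_sub_le_of_weighted_equilibrium {ι : Type*} {a b f : ι → ℝ} {E : ℝ}
    {i j : ι}
    (hi : ∃ r : ℝ, |2 * r - 1| ≤ E ∧ ∀ j, a i * f i + r * b i ≤ a j * f j + r * b j)
    (hj : ∃ r : ℝ, |2 * r - 1| ≤ E ∧ ∀ i, a j * f j + r * b j ≤ a i * f i + r * b i) :
    |(a i * f i + b i / 2) - (a j * f j + b j / 2)| ≤ E * |b i / 2 - b j / 2| := by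
  obtain ⟨r, hr, hri⟩ := hi
  obtain ⟨t, ht, htj⟩ := hj
  have h1 : ∀ {r : ℝ}, |2 * r - 1| ≤ E →
      |(2 * r - 1) * (b i / 2 - b j / 2)| ≤ E * |b i / 2 - b j / 2| := fun h => by
    rw [abs_mul]; exact mul_le_mul_of_nonneg_right h (abs_nonneg _)
  have h2 := abs_le.1 (h1 hr)
  have h3 := abs_le.1 (h1 ht)
  have h4 := hri j
  have h5 := htj i
  rw [abs_le]
  constructor <;> nlinarith

variable {ι : Type*} [Fintype ι]

theorem sum_sum_mul_sub_sq (w y : ι → ℝ) :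
    ∑ i, ∑ j, w i * w j * (y i - y j) ^ 2
      = 2 * (∑ i, w i) * (∑ i, w i * y i ^ 2) - 2 * (∑ i, w i * y i) ^ 2 := by
  have h : ∀ i j, w i * w j * (y i - y j) ^ 2
      = w i * y i ^ 2 * w j + w i * (w j * y j ^ 2) - 2 * ((w i * y i) * (w j * y j)) := by
    intro i j; ring
  simp only [h, Finset.sum_add_distrib, Finset.sum_sub_distrib, ← Finset.mul_sum,
    ← Finset.sum_mul]
  ring

/-- A centred weighted sum of squares contracts under a Lipschitz map. -/
theorem sum_mul_sq_le_of_lipschitz {w y q : ι → ℝ} {E : ℝ} (hw : ∀ i, 0 < w i)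
    (hy : ∑ i, w i * y i = 0) (hq : ∑ i, w i * q i = 0)
    (hlip : ∀ i j, |y i - y j| ≤ E * |q i - q j|) :
    ∑ i, w i * y i ^ 2 ≤ E ^ 2 * ∑ i, w i * q i ^ 2 := by
  rcases isEmpty_or_nonempty ι with hι | hι
  · simp
  have hW : 0 < ∑ i, w i := Finset.sum_pos (fun i _ => hw i) Finset.univ_nonempty
  have h1 := sum_sum_mul_sub_sq w y
  have h2 := sum_sum_mul_sub_sq w q
  have h3 : ∑ i, ∑ j, w i * w j * (y i - y j) ^ 2
      ≤ E ^ 2 * ∑ i, ∑ j, w i * w j * (q i - q j) ^ 2 := by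
    simp only [Finset.mul_sum]
    refine Finset.sum_le_sum fun i _ => Finset.sum_le_sum fun j _ => ?_
    have h4 : (y i - y j) ^ 2 ≤ E ^ 2 * (q i - q j) ^ 2 := by
      have := pow_le_pow_left₀ (abs_nonneg _) (hlip i j) 2
      rwa [sq_abs, mul_pow, sq_abs] at this
    have := mul_le_mul_of_nonneg_left h4 (mul_pos (hw i) (hw j)).le
    linarith
  rw [h1, h2, hy, hq] at h3
  have : (∑ i, w i) * ∑ i, w i * y i ^ 2 ≤ (∑ i, w i) * (E ^ 2 * ∑ i, w i * q i ^ 2) := by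
    nlinarith
  exact le_of_mul_le_mul_left this hW

/-- Around a flow that equalizes the marginal latencies, the total latency is a quadratic form. -/
theorem sum_latency_eq_add_sum_sq {a b p f : ι → ℝ} {M d : ℝ} (hp : ∑ i, p i = d)
    (hM : ∀ i, 2 * a i * p i + b i = M) (hf : ∑ i, f i = d) :
    ∑ i, f i * (a i * f i + b i)
      = ∑ i, p i * (a i * p i + b i) + ∑ i, a i * (f i - p i) ^ 2 := by
  have h : ∀ i, f i * (a i * f i + b i)
      = p i * (a i * p i + b i) + a i * (f i - p i) ^ 2 + (M * f i - M * p i) := by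
    intro i; rw [← hM i]; ring
  simp only [h, Finset.sum_add_distrib, Finset.sum_sub_distrib, ← Finset.mul_sum, hp, hf]
  ring

/-- The untolled equilibrium costs at most `4/3` of any assignment routing the same demand. -/
theorem three_mul_sum_equilibrium_le {a b h p : ι → ℝ} {Λ d : ℝ} (ha : ∀ i, 0 ≤ a i)
    (hb : ∀ i, 0 ≤ b i) (hh : ∀ i, 0 < h i) (hΛ : ∀ i, a i * h i + b i = Λ)
    (hhd : ∑ i, h i = d) (hp : ∑ i, p i = d) :
    3 * ∑ i, h i * (a i * h i + b i) ≤ 4 * ∑ i, p i * (a i * p i + b i) := by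
  have h1 : ∑ i, h i * (a i * h i + b i) = ∑ i, p i * (a i * h i + b i) := by
    simp only [hΛ, ← Finset.sum_mul, hhd, hp]
  have h2 : ∑ i, p i * (a i * h i + b i)
      ≤ ∑ i, (p i * (a i * p i + b i) + (1 / 4) * (h i * (a i * h i + b i))) := by
    refine Finset.sum_le_sum fun i _ => ?_
    nlinarith [mul_nonneg (ha i) (sq_nonneg (p i - h i / 2)), mul_nonneg (hh i).le (hb i)]
  rw [Finset.sum_add_distrib, ← Finset.mul_sum] at h2
  linarith

section ApproximateEquilibrium

variable {a b h f : ι → ℝ} {Λ d E : ℝ}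

/-- Every congestible edge stays in use when users weigh constant latencies by a factor in
`(0, 1]`. -/
theorem pos_of_weighted_equilibrium (ha : ∀ i, 0 ≤ a i)
    (hh : ∀ i, 0 < h i) (hΛ : ∀ i, a i * h i + b i = Λ) (hhd : ∑ i, h i = d)
    (hf : ∀ i, 0 ≤ f i) (hfd : ∑ i, f i = d)
    (hN : ∀ i, 0 < f i → ∃ r : ℝ, 0 < r ∧ r ≤ 1 ∧
      ∀ j, a i * f i + r * b i ≤ a j * f j + r * b j)
    {j : ι} (hj : 0 < a j) : 0 < f j := by
  by_contra hcon
  have hj0 : f j = 0 := le_antisymm (not_lt.1 hcon) (hf j)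
  have hbj : b j < Λ := by linarith [hΛ j, mul_pos hj (hh j)]
  have hlt : ∀ i, f i < h i := by
    intro i
    rcases (hf i).eq_or_lt with h0 | h0
    · rw [← h0]; exact hh i
    obtain ⟨r, hr0, hr1, hr⟩ := hN i h0
    have h1 := hr j
    rw [hj0] at h1
    have h2 : 0 ≤ a i * f i := mul_nonneg (ha i) h0.le
    have h3 : 0 ≤ b j - b i := by
      by_contra hneg
      nlinarith [mul_pos hr0 (neg_pos.2 (not_le.1 hneg))]
    have h4 : r * (b j - b i) ≤ b j - b i := mul_le_of_le_one_left h3 hr1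
    have h5 : a i * f i < a i * h i := by linarith [hΛ i]
    exact lt_of_mul_lt_mul_left h5 (ha i)
  have := Finset.sum_lt_sum_of_nonempty ⟨j, Finset.mem_univ j⟩ (fun i _ => hlt i)
  linarith

/-- If all constant edges were empty, comparison with one of them, of latency `Λ`, would cap every
other edge by its traffic in `h`, and the demand could not be met. -/
theorem exists_pos_of_weighted_equilibrium (ha : ∀ i, 0 ≤ a i)
    (hh : ∀ i, 0 < h i) (hΛ : ∀ i, a i * h i + b i = Λ) (hhd : ∑ i, h i = d)
    (hf : ∀ i, 0 ≤ f i) (hfd : ∑ i, f i = d)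
    (hN : ∀ i, 0 < f i → ∃ r : ℝ, 0 < r ∧ r ≤ 1 ∧
      ∀ j, a i * f i + r * b i ≤ a j * f j + r * b j)
    {z : ι} (hz : a z = 0) : ∃ j, a j = 0 ∧ 0 < f j := by
  by_contra! hcon
  have hfz : f z = 0 := le_antisymm (hcon z hz) (hf z)
  have hbz : b z = Λ := by simpa [hz] using hΛ z
  have hle : ∀ i, f i ≤ h i := by
    intro i
    rcases (hf i).eq_or_lt with h0 | h0
    · rw [← h0]; exact (hh i).le
    have hai : 0 < a i := (ha i).lt_of_ne fun h => (hcon i h.symm).not_gt h0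
    obtain ⟨r, hr0, hr1, hr⟩ := hN i h0
    have h1 := hr z
    rw [hfz, hbz] at h1
    have h3 : 0 ≤ Λ - b i := by linarith [hΛ i, mul_pos hai (hh i)]
    have h4 : r * (Λ - b i) ≤ Λ - b i := mul_le_of_le_one_left h3 hr1
    have h5 : a i * f i ≤ a i * h i := by linarith [hΛ i]
    exact le_of_mul_le_mul_left h5 hai
  have := Finset.sum_lt_sum (fun i (_ : i ∈ Finset.univ) => hle i)
    ⟨z, Finset.mem_univ z, by rw [hfz]; exact hh z⟩
  linarith

/-- The total latency of an equilibrium in which users weigh constant latencies by factors within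
`E / 2` of `1 / 2`. -/
theorem sum_latency_le_of_weighted_equilibrium (hE : E < 1) (ha : ∀ i, 0 ≤ a i)
    (hb : ∀ i, 0 ≤ b i)
    (hh : ∀ i, 0 < h i) (hΛ : ∀ i, a i * h i + b i = Λ) (hhd : ∑ i, h i = d)
    (hf : ∀ i, 0 ≤ f i) (hfd : ∑ i, f i = d)
    (hN : ∀ i, 0 < f i → ∃ r : ℝ, |2 * r - 1| ≤ E ∧
      ∀ j, a i * f i + r * b i ≤ a j * f j + r * b j)
    {g : ι → ℝ} (hgd : ∑ i, g i = d) :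
    ∑ i, f i * (a i * f i + b i) ≤ (1 + E ^ 2 / 3) * ∑ i, g i * (a i * g i + b i) := by
  have hN' : ∀ i, 0 < f i → ∃ r : ℝ, 0 < r ∧ r ≤ 1 ∧
      ∀ j, a i * f i + r * b i ≤ a j * f j + r * b j := by
    intro i hi
    obtain ⟨r, hr, hri⟩ := hN i hi
    rw [abs_le] at hr
    exact ⟨r, by linarith, by linarith, hri⟩
  have hpos : ∀ {j}, 0 < a j → 0 < f j := fun hj =>
    pos_of_weighted_equilibrium ha hh hΛ hhd hf hfd hN' hj
  have hlip : ∀ i j, 0 < f i → 0 < f j →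
      |(a i * f i + b i / 2) - (a j * f j + b j / 2)| ≤ E * |b i / 2 - b j / 2| :=
    fun i j hi hj => abs_sub_le_of_weighted_equilibrium (hN i hi) (hN j hj)
  obtain ⟨p, M, hpd, hM, hquad⟩ : ∃ (p : ι → ℝ) (M : ℝ), ∑ i, p i = d ∧
      (∀ i, 2 * a i * p i + b i = M) ∧
      ∑ i, a i * (f i - p i) ^ 2 ≤ E ^ 2 * ∑ i, a i * (h i - p i) ^ 2 := by
    classical
    by_cases hZ : ∃ z, a z = 0
    · obtain ⟨z, hz⟩ := hZ
      obtain ⟨z, hz, hfz⟩ := exists_pos_of_weighted_equilibrium ha hh hΛ hhd hf hfd hN' hz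
      have hbz : b z = Λ := by simpa [hz] using hΛ z
      -- Half of `h` has marginal latency `Λ` on every edge; the other half of the demand goes to
      -- the constant edge `z`, where it changes no marginal latency.
      have hM : ∀ i, 2 * a i * (h i / 2 + if i = z then d / 2 else 0) + b i = Λ := by
        intro i
        by_cases hi : i = z
        · subst hi; simp [hz, hbz]
        · simp only [hi, if_false]; linarith [hΛ i]
      refine ⟨fun i => h i / 2 + if i = z then d / 2 else 0, Λ, ?_, hM, ?_⟩
      · rw [Finset.sum_add_distrib, ← Finset.sum_div, hhd]
        simp
      · rw [Finset.mul_sum]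
        refine Finset.sum_le_sum fun i _ => ?_
        have hMi := hM i
        beta_reduce
        generalize (h i / 2 + if i = z then d / 2 else 0) = p at hMi ⊢
        rcases (ha i).eq_or_lt with h0 | h0
        · simp [← h0]
        have h1 := hlip i z (hpos h0) hfz
        rw [hz, hbz] at h1
        have h2 : a i * f i + b i / 2 - (0 * f z + Λ / 2) = a i * (f i - p) := by
          rw [← hMi]; ring
        have h3 : b i / 2 - Λ / 2 = -(a i * (h i - p)) := by
          linarith [hΛ i]
        rw [h2, h3, abs_neg] at h1
        have h4 := pow_le_pow_left₀ (abs_nonneg _) h1 2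
        rw [sq_abs, mul_pow, mul_pow, sq_abs, mul_pow] at h4
        refine le_of_mul_le_mul_left ?_ h0
        linarith
    · push Not at hZ
      have ha' : ∀ i, 0 < a i := fun i => (ha i).lt_of_ne' (hZ i)
      rcases isEmpty_or_nonempty ι with hι | hι
      · exact ⟨h, 0, hhd, fun i => hι.elim i, by simp⟩
      set W := ∑ i, (a i)⁻¹ with hW
      have hWpos : 0 < W :=
        Finset.sum_pos (fun i _ => inv_pos.2 (ha' i)) Finset.univ_nonempty
      -- Without constant edges, the missing `d / 2` is spread in proportion to `(a i)⁻¹`, which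
      -- raises all marginal latencies equally.
      have hpd : ∑ i, (h i / 2 + d / 2 / W * (a i)⁻¹) = d := by
        rw [Finset.sum_add_distrib, ← Finset.sum_div, hhd, ← Finset.mul_sum, ← hW]
        field_simp; ring
      have hM : ∀ i, 2 * a i * (h i / 2 + d / 2 / W * (a i)⁻¹) + b i = Λ + d / W := by
        intro i
        have := (ha' i).ne'
        rw [← hΛ i]
        field_simp; ring
      obtain ⟨p, hp⟩ : ∃ p : ι → ℝ, ∀ i, p i = h i / 2 + d / 2 / W * (a i)⁻¹ :=
        ⟨_, fun _ => rfl⟩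
      simp only [← hp] at hpd hM
      refine ⟨p, Λ + d / W, hpd, hM, ?_⟩
      have key := sum_mul_sq_le_of_lipschitz (w := fun i => (a i)⁻¹)
        (y := fun i => a i * (f i - p i)) (q := fun i => a i * (h i - p i)) (E := E)
        (fun i => inv_pos.2 (ha' i)) ?_ ?_ ?_
      · have hsq : ∀ i (x : ℝ), (a i)⁻¹ * (a i * x) ^ 2 = a i * x ^ 2 := by
          intro i x
          have := (ha' i).ne'
          field_simp
        simpa only [hsq] using key
      · simp only [inv_mul_cancel_left₀ (hZ _), Finset.sum_sub_distrib, hfd, hpd, sub_self]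
      · simp only [inv_mul_cancel_left₀ (hZ _), Finset.sum_sub_distrib, hhd, hpd, sub_self]
      · intro i j
        have h1 := hlip i j (hpos (ha' i)) (hpos (ha' j))
        have h2 : a i * f i + b i / 2 - (a j * f j + b j / 2)
            = a i * (f i - p i) - a j * (f j - p j) := by linarith [hM i, hM j]
        have h3 : b i / 2 - b j / 2 = -(a i * (h i - p i) - a j * (h j - p j)) := by
          linarith [hM i, hM j, hΛ i, hΛ j]
        rwa [h2, h3, abs_neg] at h1
  have h1 := sum_latency_eq_add_sum_sq hpd hM hfd
  have h2 := sum_latency_eq_add_sum_sq hpd hM hhd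
  have h3 := sum_latency_eq_add_sum_sq hpd hM hgd
  have h4 : 0 ≤ ∑ i, a i * (g i - p i) ^ 2 :=
    Finset.sum_nonneg fun i _ => mul_nonneg (ha i) (sq_nonneg _)
  have h5 := three_mul_sum_equilibrium_le ha hb hh hΛ hhd hpd
  -- By `h2` and `h5` the quadratic form at `h` is at most a third of the latency of `p`, and `p`
  -- costs no more than `g`.
  rw [h3]
  nlinarith [sq_nonneg E, mul_nonneg (sq_nonneg E) h4,
    mul_le_mul_of_nonneg_left h5 (sq_nonneg E)]

end ApproximateEquilibrium

end Analysis

/-! ### Nash flows and the upper bound on the price of anarchy -/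

namespace ParallelGame

variable {G : ParallelGame} {s : G.Users → ℝ} {T : Mechanism} {f : G.Flow}

theorem IsNash.nonneg (hf : G.IsNash s T f) (e : Fin G.n) : 0 ≤ f e := by
  obtain ⟨P, -, hPf, -⟩ := hf
  rw [hPf]
  exact measureReal_nonneg

theorem IsNash.sum_eq (hf : G.IsNash s T f) : ∑ e, f e = G.demand := by
  obtain ⟨P, hP, hPf, -⟩ := hf
  have hm : ∀ e, MeasurableSet (Subtype.val '' {x : G.Users | P x = e}) := fun e =>
    (MeasurableEmbedding.subtype_coe measurableSet_Icc).measurableSet_image.2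
      (hP (measurableSet_singleton e))
  have hU : ⋃ e, (Subtype.val '' {x : G.Users | P x = e}) = Set.Icc (0 : ℝ) G.demand := by
    ext x
    simp
  have hd : Pairwise (Function.onFun Disjoint
      fun e => (Subtype.val '' {x : G.Users | P x = e} : Set ℝ)) := by
    intro e e' hne
    refine Set.disjoint_left.2 ?_
    rintro _ ⟨x, hx, rfl⟩ ⟨y, hy, hxy⟩
    rw [Subtype.val_injective hxy] at hy
    exact hne (hx.symm.trans hy)
  simp only [hPf]
  have hfin : ∀ e, (volume : Measure ℝ) (Subtype.val '' {x : G.Users | P x = e}) ≠ ∞ := by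
    intro e
    refine ((measure_mono ?_).trans_lt (isCompact_Icc (a := (0 : ℝ))
      (b := G.demand)).measure_lt_top).ne
    rintro _ ⟨x, -, rfl⟩
    exact x.2
  rw [← measureReal_iUnion_fintype hd hm hfin, hU]
  simp [Measure.real]

/-- Every edge in use is a best response of some user. -/
theorem IsNash.exists_user (hf : G.IsNash s T f) {e : Fin G.n} (he : 0 < f e) :
    ∃ x, ∀ e', G.cost T f (s x) e ≤ G.cost T f (s x) e' := by
  obtain ⟨P, -, hPf, hbest⟩ := hf
  obtain ⟨-, x, hx, -⟩ : (Subtype.val '' {x : G.Users | P x = e}).Nonempty := by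
    by_contra h
    rw [Set.not_nonempty_iff_eq_empty] at h
    rw [hPf, h] at he
    simp at he
  refine ⟨x, fun e' => ?_⟩
  have hx' : P x = e := hx
  simpa only [hx'] using hbest x e'

/-- The effective weight `(1 + σ k₂) / (1 + σ k₁)` of constant latencies lies within `E / 2` of the
socially optimal `1 / 2`. -/
theorem totalLatency_le_of_isNash {k₁ k₂ E : ℝ} (hG : G.FullyUtilized) (hE : E < 1)
    (hk : ∀ x, 0 < 1 + s x * k₁ ∧ |1 + s x * (2 * k₂ - k₁)| ≤ E * (1 + s x * k₁))
    (hf : G.IsNash s (affineMechanism k₁ k₂) f) {g : G.Flow} (hg : g ∈ G.feasible) :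
    G.totalLatency f ≤ (1 + E ^ 2 / 3) * G.totalLatency g := by
  obtain ⟨h, hh, hpos⟩ := hG
  have hle : ∀ e e', (G.latency e).a * h e + (G.latency e).b
      ≤ (G.latency e').a * h e' + (G.latency e').b := by
    intro e e'
    obtain ⟨x, hx⟩ := hh.exists_user (hpos e)
    simpa [cost, AffineLatency.eval] using hx e'
  obtain ⟨Λ, hΛ⟩ : ∃ Λ : ℝ, ∀ e, (G.latency e).a * h e + (G.latency e).b = Λ := by
    rcases isEmpty_or_nonempty (Fin G.n) with hι | ⟨⟨e₀⟩⟩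
    · exact ⟨0, fun e => hι.elim e⟩
    · exact ⟨_, fun e => le_antisymm (hle e e₀) (hle e₀ e)⟩
  refine sum_latency_le_of_weighted_equilibrium (a := fun e => ((G.latency e).a : ℝ))
    (b := fun e => ((G.latency e).b : ℝ)) hE (fun e => NNReal.coe_nonneg _)
    (fun e => NNReal.coe_nonneg _) hpos hΛ hh.sum_eq hf.nonneg hf.sum_eq ?_ hg.2
  intro e he
  obtain ⟨x, hx⟩ := hf.exists_user he
  obtain ⟨hA, hAE⟩ := hk x
  refine ⟨(1 + s x * k₂) / (1 + s x * k₁), ?_, fun e' => ?_⟩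
  · have h1 : 2 * ((1 + s x * k₂) / (1 + s x * k₁)) - 1
        = (1 + s x * (2 * k₂ - k₁)) / (1 + s x * k₁) := by
      field_simp; ring
    rwa [h1, abs_div, abs_of_pos hA, div_le_iff₀ hA]
  · have h2 : ∀ i, (G.latency i).a * f i + (1 + s x * k₂) / (1 + s x * k₁) * (G.latency i).b
        = G.cost (affineMechanism k₁ k₂) f (s x) i / (1 + s x * k₁) := by
      intro i
      simp only [cost, AffineLatency.eval, affineMechanism]
      field_simp; ring
    simp only [h2]
    exact div_le_div_of_nonneg_right (hx e') hA.le

end ParallelGame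

theorem priceOfAnarchy_affineMechanism_le {SL SU k₁ k₂ E : ℝ} (hE : E < 1)
    (hk : ∀ σ ∈ Set.Icc SL SU, 0 < 1 + σ * k₁ ∧
      |1 + σ * (2 * k₂ - k₁)| ≤ E * (1 + σ * k₁)) :
    priceOfAnarchy SL SU (affineMechanism k₁ k₂) ≤ ENNReal.ofReal (1 + E ^ 2 / 3) := by
  refine iSup_le fun G => iSup_le fun hG => iSup_le fun s => iSup_le fun hs => ?_
  refine ENNReal.div_le_of_le_mul (iSup_le fun f => iSup_le fun hf => ?_)
  have hC : 0 < 1 + E ^ 2 / 3 := by positivity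
  have hC0 : ENNReal.ofReal (1 + E ^ 2 / 3) ≠ 0 := by simpa using hC
  rw [mul_comm, ← ENNReal.div_le_iff hC0 ENNReal.ofReal_ne_top]
  refine le_iInf fun g => le_iInf fun hg => ?_
  rw [ENNReal.div_le_iff hC0 ENNReal.ofReal_ne_top, mul_comm, ← ENNReal.ofReal_mul hC.le]
  exact ENNReal.ofReal_le_ofReal
    (ParallelGame.totalLatency_le_of_isNash hG hE (fun x => hk _ (hs x)) hf hg)

/-! ### Pigou's network and the lower bound -/

/-- Pigou's network: latencies `f` and `1`, with a mass `1 + ε` of traffic. -/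
def pigouGame (ε : ℝ≥0) : ParallelGame where
  n := 2
  latency := ![⟨1, 0⟩, ⟨0, 1⟩]
  demand := 1 + ε

namespace ParallelGame

/-- Sending all users to a commonly cheapest edge is a Nash flow. -/
theorem isNash_single {G : ParallelGame} {s : G.Users → ℝ} {T : Mechanism} {f : G.Flow}
    (e₀ : Fin G.n) (hf : ∀ e, f e = if e = e₀ then (G.demand : ℝ) else 0)
    (hbest : ∀ x e, G.cost T f (s x) e₀ ≤ G.cost T f (s x) e) : G.IsNash s T f := by
  refine ⟨fun _ => e₀, measurable_const, fun e => ?_, hbest⟩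
  rw [hf]
  by_cases h : e = e₀
  · subst h
    have hU : Subtype.val '' {x : G.Users | e = e} = Set.Icc (0 : ℝ) G.demand := by
      ext; simp
    rw [if_pos rfl, hU, Real.volume_real_Icc_of_le (NNReal.coe_nonneg _), sub_zero]
  · simp [h, Ne.symm h]

end ParallelGame

open ParallelGame

variable {ε : ℝ≥0}

theorem pigouGame_totalLatency (ε : ℝ≥0) (t u : ℝ) :
    (pigouGame ε).totalLatency (![t, u] : Fin 2 → ℝ) = t ^ 2 + u := by
  change ∑ e : Fin 2, _ = _
  simp [Fin.sum_univ_two, pigouGame, AffineLatency.eval, sq]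

theorem pigouGame_cost_zero (k₁ k₂ t u σ : ℝ) :
    (pigouGame ε).cost (affineMechanism k₁ k₂) (![t, u] : Fin 2 → ℝ) σ (0 : Fin 2)
      = (1 + σ * k₁) * t := by
  simp [ParallelGame.cost, pigouGame, AffineLatency.eval, affineMechanism]
  ring

theorem pigouGame_cost_one (k₁ k₂ t u σ : ℝ) :
    (pigouGame ε).cost (affineMechanism k₁ k₂) (![t, u] : Fin 2 → ℝ) σ (1 : Fin 2)
      = 1 + σ * k₂ := by
  simp [ParallelGame.cost, pigouGame, AffineLatency.eval, affineMechanism]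

/-- An interior flow on Pigou's network is a Nash flow if all users are indifferent. -/
theorem pigouGame_isNash_of_indifferent {k₁ k₂ t σ : ℝ} (ht0 : 0 ≤ t) (ht1 : t ≤ 1 + ε)
    (hcost : (1 + σ * k₁) * t = 1 + σ * k₂) :
    (pigouGame ε).IsNash (fun _ => σ) (affineMechanism k₁ k₂)
      (![t, 1 + ε - t] : Fin 2 → ℝ) := by
  classical
  have hd : ((pigouGame ε).demand : ℝ) = 1 + ε := by simp [pigouGame]
  have hset : MeasurableSet {x : (pigouGame ε).Users | (x : ℝ) < t} :=
    measurable_subtype_coe measurableSet_Iio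
  refine ⟨fun x => if (x : ℝ) < t then (0 : Fin 2) else (1 : Fin 2),
    Measurable.ite hset measurable_const measurable_const, fun e => ?_, fun x e => ?_⟩
  · change Fin 2 at e
    fin_cases e
    · have : (Subtype.val '' {x : (pigouGame ε).Users |
          (if (x : ℝ) < t then (0 : Fin 2) else (1 : Fin 2)) = 0}) = Set.Ico 0 t := by
        ext y
        simp only [Set.mem_image, Set.mem_ofPred_eq, Subtype.exists, Set.mem_Icc, hd, Set.mem_Ico]
        constructor
        · rintro ⟨z, hz, h, rfl⟩
          refine ⟨hz.1, ?_⟩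
          by_contra hlt
          simp [hlt] at h
        · rintro ⟨h0, h1⟩
          exact ⟨y, ⟨h0, by linarith⟩, by simp [h1], rfl⟩
      refine Eq.trans ?_ (congrArg (volume : Measure ℝ).real this).symm
      simp [Measure.real, ht0]
    · have : (Subtype.val '' {x : (pigouGame ε).Users |
          (if (x : ℝ) < t then (0 : Fin 2) else (1 : Fin 2)) = 1}) = Set.Icc t (1 + ε) := by
        ext y
        simp only [Set.mem_image, Set.mem_ofPred_eq, Subtype.exists, Set.mem_Icc, hd]
        constructor
        · rintro ⟨z, hz, h, rfl⟩
          refine ⟨?_, hz.2⟩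
          by_contra hlt
          simp [not_le.1 hlt] at h
        · rintro ⟨h0, h1⟩
          exact ⟨y, ⟨by linarith, h1⟩, by simp [not_lt.2 h0], rfl⟩
      refine Eq.trans ?_ (congrArg (volume : Measure ℝ).real this).symm
      simp [Measure.real, ht1]
  · have hall : ∀ e : Fin 2, (pigouGame ε).cost (affineMechanism k₁ k₂)
        (![t, 1 + ε - t] : Fin 2 → ℝ) σ e = 1 + σ * k₂ := by
      intro e
      fin_cases e
      · exact (pigouGame_cost_zero k₁ k₂ t _ σ).trans hcost
      · exact pigouGame_cost_one k₁ k₂ t _ σ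
    exact ((hall _).trans (hall e).symm).le

theorem pigouGame_fullyUtilized (hε : 0 < ε) : (pigouGame ε).FullyUtilized := by
  refine ⟨(![1, 1 + ε - 1] : Fin 2 → ℝ), ?_, ?_⟩
  · have := pigouGame_isNash_of_indifferent (ε := ε) (k₁ := 0) (k₂ := 0) (t := 1) (σ := 1)
      zero_le_one (by simp) (by simp)
    have h0 : affineMechanism 0 0 = fun _ _ => 0 := by
      funext l f; simp [affineMechanism]
    rwa [h0] at this
  · intro e
    change Fin 2 at e
    fin_cases e
    · exact zero_lt_one
    · change (0 : ℝ) < 1 + ε - 1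
      simpa using hε

theorem pigouGame_optLatency_le (ε : ℝ≥0) :
    (pigouGame ε).optLatency ≤ ENNReal.ofReal (3 / 4 + ε) := by
  have hmem : (![1 / 2, 1 / 2 + ε] : Fin 2 → ℝ) ∈ (pigouGame ε).feasible := by
    refine ⟨fun e => ?_, ?_⟩
    · change Fin 2 at e
      fin_cases e
      · change (0 : ℝ) ≤ 1 / 2
        norm_num
      · change (0 : ℝ) ≤ 1 / 2 + ε
        positivity
    · change ∑ e : Fin 2, (![1 / 2, 1 / 2 + ε] : Fin 2 → ℝ) e = ((1 + ε : ℝ≥0) : ℝ)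
      rw [Fin.sum_univ_two]
      push_cast
      change (1 / 2 + (1 / 2 + ε) : ℝ) = 1 + ε
      ring
  refine (iInf₂_le _ hmem).trans ?_
  rw [pigouGame_totalLatency]
  refine ENNReal.ofReal_le_ofReal (le_of_eq ?_)
  ring

/-- On Pigou's network a mechanism that distorts the effective weight of constant latencies by
`E / 2` leaves a Nash flow of high total latency. -/
theorem exists_pigouGame_isNash {k₁ k₂ σ E : ℝ} (hE0 : 0 ≤ E) (hE1 : E ≤ 1)
    (h : 0 < 1 + σ * k₁ → E * (1 + σ * k₁) ≤ |1 + σ * (2 * k₂ - k₁)|) :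
    ∃ f, (pigouGame ε).IsNash (fun _ => σ) (affineMechanism k₁ k₂) f ∧
      3 / 4 + E ^ 2 / 4 + ε ≤ (pigouGame ε).totalLatency f := by
  have hd : ((pigouGame ε).demand : ℝ) = 1 + ε := by simp [pigouGame]
  have hε : (0 : ℝ) ≤ ε := ε.2
  have hE2 : E ^ 2 ≤ 1 := by nlinarith
  -- The two corner flows, with all users on one edge, cost at least `1 + ε`, which suffices because
  -- `E ≤ 1`.
  have hone : (1 + σ * k₁) * (1 + ε) ≤ 1 + σ * k₂ →
      ∃ f, (pigouGame ε).IsNash (fun _ => σ) (affineMechanism k₁ k₂) f ∧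
        3 / 4 + E ^ 2 / 4 + ε ≤ (pigouGame ε).totalLatency f := by
    intro hc
    refine ⟨(![1 + ε, 0] : Fin 2 → ℝ), isNash_single (0 : Fin 2) ?_ ?_, ?_⟩
    · intro e
      change Fin 2 at e
      fin_cases e
      · exact hd.symm
      · rfl
    · intro x e
      change Fin 2 at e
      rw [pigouGame_cost_zero]
      fin_cases e
      · exact (pigouGame_cost_zero ..).ge
      · exact hc.trans (pigouGame_cost_one ..).ge
    · rw [pigouGame_totalLatency]
      nlinarith
  have htwo : 1 + σ * k₂ ≤ 0 →
      ∃ f, (pigouGame ε).IsNash (fun _ => σ) (affineMechanism k₁ k₂) f ∧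
        3 / 4 + E ^ 2 / 4 + ε ≤ (pigouGame ε).totalLatency f := by
    intro hc
    refine ⟨(![0, 1 + ε] : Fin 2 → ℝ), isNash_single (1 : Fin 2) ?_ ?_, ?_⟩
    · intro e
      change Fin 2 at e
      fin_cases e
      · rfl
      · exact hd.symm
    · intro x e
      change Fin 2 at e
      rw [pigouGame_cost_one]
      fin_cases e
      · refine hc.trans (Eq.ge ?_)
        exact (pigouGame_cost_zero ..).trans (mul_zero _)
      · exact (pigouGame_cost_one ..).ge
    · rw [pigouGame_totalLatency]
      nlinarith
  rcases le_or_gt (1 + σ * k₂) 0 with hB | hB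
  · exact htwo hB
  rcases le_or_gt ((1 + σ * k₁) * (1 + ε)) (1 + σ * k₂) with hAB | hAB
  · exact hone hAB
  have hA : 0 < 1 + σ * k₁ := by
    by_contra hneg
    nlinarith
  refine ⟨_, pigouGame_isNash_of_indifferent (t := (1 + σ * k₂) / (1 + σ * k₁))
    (by positivity) ?_ (mul_div_cancel₀ _ hA.ne'), ?_⟩
  · rw [div_le_iff₀ hA]
    linarith
  -- For traffic `t` on the congestible edge the total latency is `3/4 + (2 t - 1)² / 4 + ε`, and
  -- here `t` is the effective weight itself.
  · rw [pigouGame_totalLatency]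
    have h1 : E ≤ |2 * ((1 + σ * k₂) / (1 + σ * k₁)) - 1| := by
      have h2 : 2 * ((1 + σ * k₂) / (1 + σ * k₁)) - 1
          = (1 + σ * (2 * k₂ - k₁)) / (1 + σ * k₁) := by
        field_simp; ring
      rw [h2, abs_div, abs_of_pos hA, le_div_iff₀ hA]
      exact h hA
    have h3 := pow_le_pow_left₀ hE0 h1 2
    rw [sq_abs] at h3
    nlinarith

/-- The surplus `ε > 0` keeps the constant edge in use without tolls; the bound follows as `ε → 0`.
A homogeneous population of sensitivity `σ` is enough. -/
theorem le_priceOfAnarchy_affineMechanism {SL SU k₁ k₂ σ E : ℝ} (hσ : σ ∈ Set.Icc SL SU)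
    (hE0 : 0 ≤ E) (hE1 : E ≤ 1)
    (h : 0 < 1 + σ * k₁ → E * (1 + σ * k₁) ≤ |1 + σ * (2 * k₂ - k₁)|) :
    ENNReal.ofReal (1 + E ^ 2 / 3) ≤ priceOfAnarchy SL SU (affineMechanism k₁ k₂) := by
  have hε : ∀ ε : ℝ, 0 < ε →
      ENNReal.ofReal ((3 / 4 + E ^ 2 / 4 + ε) / (3 / 4 + ε))
        ≤ priceOfAnarchy SL SU (affineMechanism k₁ k₂) := by
    intro ε hε
    lift ε to ℝ≥0 using hε.le
    obtain ⟨f, hf, hfL⟩ := exists_pigouGame_isNash (ε := ε) hE0 hE1 h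
    refine le_iSup_of_le (pigouGame ε) <| le_iSup_of_le
      (pigouGame_fullyUtilized (NNReal.coe_pos.1 hε)) <| le_iSup_of_le (fun _ => σ) <|
      le_iSup_of_le (fun _ => hσ) ?_
    rw [ENNReal.ofReal_div_of_pos (by positivity)]
    refine ENNReal.div_le_div ?_ (pigouGame_optLatency_le ε)
    exact (ENNReal.ofReal_le_ofReal hfL).trans
      (le_iSup₂ (f := fun f (_ : (pigouGame ε).IsNash (fun _ => σ) (affineMechanism k₁ k₂) f) =>
        ENNReal.ofReal ((pigouGame ε).totalLatency f)) f hf)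
  have hcont : ContinuousAt (fun ε : ℝ => (3 / 4 + E ^ 2 / 4 + ε) / (3 / 4 + ε)) 0 := by
    refine ContinuousAt.div (by fun_prop) (by fun_prop) (by norm_num)
  have hlim : Filter.Tendsto
      (fun ε : ℝ => ENNReal.ofReal ((3 / 4 + E ^ 2 / 4 + ε) / (3 / 4 + ε)))
      (nhdsWithin 0 (Set.Ioi 0)) (nhds (ENNReal.ofReal (1 + E ^ 2 / 3))) := by
    refine ENNReal.tendsto_ofReal ?_
    have := hcont.tendsto.mono_left (nhdsWithin_le_nhds (s := Set.Ioi 0))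
    convert this using 2
    ring
  exact le_of_tendsto hlim (eventually_nhdsWithin_of_forall hε)

/-! ### Admissible coefficients -/

/-- The latencies `f` and `1` isolate `k₁` and `k₂`, so the bound constrains each coefficient
separately. -/
theorem mem_affineTolls_iff {β : ℝ} {T : Mechanism} :
    T ∈ affineTolls β ↔
      ∃ k₁ ∈ Set.Icc 0 β, ∃ k₂ ∈ Set.Icc 0 β, T = affineMechanism k₁ k₂ := by
  constructor
  · rintro ⟨⟨k₁, k₂, rfl⟩, hT⟩
    have h1 := hT ⟨1, 0⟩ 1 zero_le_one
    have h2 := hT ⟨0, 1⟩ 0 le_rfl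
    simp only [affineMechanism, AffineLatency.eval, NNReal.coe_one, NNReal.coe_zero, mul_one,
      mul_zero, add_zero, zero_add] at h1 h2
    exact ⟨k₁, h1, k₂, h2, rfl⟩
  · rintro ⟨k₁, h1, k₂, h2, rfl⟩
    refine ⟨⟨k₁, k₂, rfl⟩, fun l f hf => ?_⟩
    have ha : 0 ≤ l.a * f := mul_nonneg l.a.2 hf
    have hb : (0 : ℝ) ≤ l.b := l.b.2
    simp only [affineMechanism, AffineLatency.eval, Set.mem_Icc]
    constructor
    · nlinarith [mul_nonneg h1.1 ha, mul_nonneg h2.1 hb]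
    · nlinarith [mul_le_mul_of_nonneg_right h1.2 ha, mul_le_mul_of_nonneg_right h2.2 hb]

theorem mem_affineSubsidies_iff {β : ℝ} {T : Mechanism} :
    T ∈ affineSubsidies β ↔
      ∃ k₁ ∈ Set.Icc (-β) 0, ∃ k₂ ∈ Set.Icc (-β) 0, T = affineMechanism k₁ k₂ := by
  constructor
  · rintro ⟨⟨k₁, k₂, rfl⟩, hT⟩
    have h1 := hT ⟨1, 0⟩ 1 zero_le_one
    have h2 := hT ⟨0, 1⟩ 0 le_rfl
    simp only [affineMechanism, AffineLatency.eval, NNReal.coe_one, NNReal.coe_zero, mul_one,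
      mul_zero, add_zero, zero_add] at h1 h2
    exact ⟨k₁, h1, k₂, h2, rfl⟩
  · rintro ⟨k₁, h1, k₂, h2, rfl⟩
    refine ⟨⟨k₁, k₂, rfl⟩, fun l f hf => ?_⟩
    have ha : 0 ≤ l.a * f := mul_nonneg l.a.2 hf
    have hb : (0 : ℝ) ≤ l.b := l.b.2
    simp only [affineMechanism, AffineLatency.eval, Set.mem_Icc]
    constructor
    · nlinarith [mul_le_mul_of_nonneg_right h1.1 ha, mul_le_mul_of_nonneg_right h2.1 hb]
    · nlinarith [mul_le_mul_of_nonneg_right h1.2 ha, mul_le_mul_of_nonneg_right h2.2 hb]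

/-! ### Optimal distortions for tolls and subsidies -/

section Distortion

variable {SL SU : ℝ}

/-- It is enough to bound the distortion of the weight of constant latencies at the extreme
sensitivities. -/
theorem priceOfAnarchy_affineMechanism_le_of_endpoints {k₁ k₂ E : ℝ} (hE : E < 1)
    (hA : 0 < 1 + SL * k₁) (hA' : 0 < 1 + SU * k₁)
    (hL : |1 + SL * (2 * k₂ - k₁)| ≤ E * (1 + SL * k₁))
    (hU : |1 + SU * (2 * k₂ - k₁)| ≤ E * (1 + SU * k₁)) :
    priceOfAnarchy SL SU (affineMechanism k₁ k₂) ≤ ENNReal.ofReal (1 + E ^ 2 / 3) := by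
  refine priceOfAnarchy_affineMechanism_le hE fun σ hσ => ?_
  rw [abs_le] at *
  -- Once the absolute value is split, every condition is affine in `σ`.
  have hlin : ∀ c e : ℝ, 0 ≤ c + e * SL → 0 ≤ c + e * SU → 0 ≤ c + e * σ := by
    intro c e h1 h2
    rcases le_total 0 e with he | he
    · nlinarith [hσ.1]
    · nlinarith [hσ.2]
  refine ⟨?_, ?_, ?_⟩
  · rcases le_total 0 k₁ with he | he
    · nlinarith [hσ.1]
    · nlinarith [hσ.2]
  · linarith [hlin (E + 1) (E * k₁ + (2 * k₂ - k₁)) (by linarith) (by linarith)]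
  · linarith [hlin (E - 1) (E * k₁ - (2 * k₂ - k₁)) (by linarith) (by linarith)]

theorem le_priceOfAnarchy_of_spread (hSL : 0 < SL) (hle : SL ≤ SU) (hnorm : SL * SU = 1)
    {k₁ k₂ E : ℝ} (hE0 : 0 ≤ E) (hE1 : E ≤ 1) (hspread : E * (SU + SL + 2 * k₁) ≤ SU - SL) :
    ENNReal.ofReal (1 + E ^ 2 / 3) ≤ priceOfAnarchy SL SU (affineMechanism k₁ k₂) := by
  by_cases hL : 0 < 1 + SL * k₁ → E * (1 + SL * k₁) ≤ |1 + SL * (2 * k₂ - k₁)|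
  · exact le_priceOfAnarchy_affineMechanism ⟨le_rfl, hle⟩ hE0 hE1 hL
  refine le_priceOfAnarchy_affineMechanism ⟨hle, le_rfl⟩ hE0 hE1 ?_
  by_contra hU
  push Not at hL hU
  have hSU : 0 < SU := hSL.trans_le hle
  -- Weighting the condition at `SL` by `SU` and the one at `SU` by `SL` gives `2 k₂ - k₁` opposite
  -- coefficients, as `SL * SU = 1`; the sum is free of `k₂` and contradicts `hspread`.
  have h1 := mul_lt_mul_of_pos_left ((le_abs_self _).trans_lt hL.2) hSU
  have h2 := mul_lt_mul_of_pos_left ((neg_le_abs _).trans_lt hU.2) hSL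
  have h3 : SU * (1 + SL * (2 * k₂ - k₁)) = SU + (2 * k₂ - k₁) := by
    linear_combination (2 * k₂ - k₁) * hnorm
  have h4 : SL * (-(1 + SU * (2 * k₂ - k₁))) = -SL - (2 * k₂ - k₁) := by
    linear_combination (-(2 * k₂ - k₁)) * hnorm
  have h5 : SU * (E * (1 + SL * k₁)) = E * (SU + k₁) := by
    linear_combination (E * k₁) * hnorm
  have h6 : SL * (E * (1 + SU * k₁)) = E * (SL + k₁) := by
    linear_combination (E * k₁) * hnorm
  rw [h3, h5] at h1
  rw [h4, h6] at h2
  linarith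

/-- The distortion that an optimal toll with bound `β` leaves. -/
noncomputable def tollDistortion (SL SU β : ℝ) : ℝ :=
  if β ≤ 1 then (1 - SL * β) / (1 + SL * β) else (SU - SL) / (SU + SL + 2 * β)

/-- The distortion that an optimal subsidy with bound `β` leaves. -/
noncomputable def subsidyDistortion (SL SU β : ℝ) : ℝ :=
  if β * (SU + SL) ≤ 1 then 1 - 2 * SL * β else (SU - SL) / (SU + SL)

theorem isOptimalMechanism_of_bounds {M : Set Mechanism} {T₀ : Mechanism} {c : ℝ≥0∞}
    (hT₀ : T₀ ∈ M) (hupper : priceOfAnarchy SL SU T₀ ≤ c)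
    (hlower : ∀ T ∈ M, c ≤ priceOfAnarchy SL SU T) :
    (∃ T, IsOptimalMechanism SL SU M T) ∧
      ∀ T, IsOptimalMechanism SL SU M T → priceOfAnarchy SL SU T = c :=
  ⟨⟨T₀, hT₀, fun T hT => hupper.trans (hlower T hT)⟩,
    fun T hT => le_antisymm ((hT.2 T₀ hT₀).trans hupper) (hlower T hT.1)⟩

variable (hSL : 0 < SL) (hle : SL ≤ SU)
include hSL hle

theorem subsidyDistortion_nonneg {β : ℝ} (hβ : 0 < β) : 0 ≤ subsidyDistortion SL SU β := by
  unfold subsidyDistortion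
  split_ifs with h
  · nlinarith
  · exact div_nonneg (by linarith) (by linarith)

theorem tollDistortion_lt_one {β : ℝ} (hβ : 0 < β) : tollDistortion SL SU β < 1 := by
  have h0 := mul_pos hSL hβ
  unfold tollDistortion
  split_ifs with h
  · rw [div_lt_one (by linarith)]; linarith
  · rw [div_lt_one (by linarith)]; linarith

theorem subsidyDistortion_lt_one {β : ℝ} (hβ : 0 < β) : subsidyDistortion SL SU β < 1 := by
  have h0 := mul_pos hSL hβ
  unfold subsidyDistortion
  split_ifs with h
  · linarith
  · rw [div_lt_one (by linarith)]; linarith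

variable (hnorm : SL * SU = 1)
include hnorm

theorem tollDistortion_nonneg {β : ℝ} (hβ : 0 < β) : 0 ≤ tollDistortion SL SU β := by
  have hSL1 : SL ≤ 1 := by nlinarith
  unfold tollDistortion
  split_ifs with h
  · exact div_nonneg (by nlinarith) (by positivity)
  · exact div_nonneg (by linarith) (by linarith)

theorem optimal_affineTolls {β : ℝ} (hβ : 0 < β) :
    (∃ T, IsOptimalMechanism SL SU (affineTolls β) T) ∧
      ∀ T, IsOptimalMechanism SL SU (affineTolls β) T →
        priceOfAnarchy SL SU T = ENNReal.ofReal (1 + tollDistortion SL SU β ^ 2 / 3) := by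
  have hSU : 0 < SU := hSL.trans_le hle
  have hE0 := tollDistortion_nonneg hSL hle hnorm hβ
  have hE1 := tollDistortion_lt_one hSL hle hβ
  have hSLβ := mul_pos hSL hβ
  have hSUβ := mul_pos hSU hβ
  rcases le_or_gt β 1 with hβ1 | hβ1
  · have hE : tollDistortion SL SU β = (1 - SL * β) / (1 + SL * β) := if_pos hβ1
    have hEA : tollDistortion SL SU β * (1 + SL * β) = 1 - SL * β := by
      rw [hE, div_mul_cancel₀ _ (by positivity)]
    refine isOptimalMechanism_of_bounds (T₀ := affineMechanism β 0)
      (mem_affineTolls_iff.2 ⟨β, ⟨hβ.le, le_rfl⟩, 0, ⟨le_rfl, hβ.le⟩, rfl⟩)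
      (priceOfAnarchy_affineMechanism_le_of_endpoints hE1 (by positivity) (by positivity)
        ?_ ?_) ?_
    · rw [hEA, abs_of_nonneg] <;> nlinarith
    · have hU1 : 1 - SL * β ≤ tollDistortion SL SU β * (1 + SU * β) := by
        rw [← hEA]
        exact mul_le_mul_of_nonneg_left (by nlinarith) hE0
      -- After clearing denominators this is `β² ≤ 1`: up to `β = 1` the users at `SU` are distorted
      -- no more than those at `SL`.
      have hU2 : SU * β - 1 ≤ tollDistortion SL SU β * (1 + SU * β) := by
        have hprod : SL * β * (SU * β) = β ^ 2 := by linear_combination β ^ 2 * hnorm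
        rw [hE, div_mul_eq_mul_div, le_div_iff₀ (by positivity)]
        nlinarith
      rw [abs_le]
      constructor <;> nlinarith
    · rintro T hT
      obtain ⟨k₁, hk₁, k₂, hk₂, rfl⟩ := mem_affineTolls_iff.1 hT
      refine le_priceOfAnarchy_affineMechanism ⟨le_rfl, hle⟩ hE0 hE1.le fun _ => ?_
      refine le_trans ?_ (le_abs_self _)
      have h1 : tollDistortion SL SU β * (1 + SL * k₁)
          ≤ tollDistortion SL SU β * (1 + SL * β) :=
        mul_le_mul_of_nonneg_left (by nlinarith [hk₁.2]) hE0
      nlinarith [mul_nonneg hSL.le hk₂.1, mul_le_mul_of_nonneg_left hk₁.2 hSL.le]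
  · have hE : tollDistortion SL SU β = (SU - SL) / (SU + SL + 2 * β) := if_neg hβ1.not_ge
    have hD : 0 < SU + SL + 2 * β := by positivity
    have hED : tollDistortion SL SU β * (SU + SL + 2 * β) = SU - SL := by
      rw [hE, div_mul_cancel₀ _ hD.ne']
    -- This `k₂` balances the extremes: the signed distortions at `SL` and `SU` become opposite. It
    -- is nonnegative, hence a toll, precisely because `β ≥ 1`.
    refine isOptimalMechanism_of_bounds
      (T₀ := affineMechanism β ((β ^ 2 - 1) / (SU + SL + 2 * β)))
      (mem_affineTolls_iff.2 ⟨β, ⟨hβ.le, le_rfl⟩, _,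
        ⟨div_nonneg (by nlinarith) hD.le, ?_⟩, rfl⟩)
      (priceOfAnarchy_affineMechanism_le_of_endpoints hE1 (by positivity) (by positivity)
        ?_ ?_) ?_
    · rw [div_le_iff₀ hD]
      nlinarith
    · have h1 : 1 + SL * (2 * ((β ^ 2 - 1) / (SU + SL + 2 * β)) - β)
          = tollDistortion SL SU β * (1 + SL * β) := by
        rw [hE]
        field_simp
        linear_combination (-2 * β) * hnorm
      rw [h1, abs_of_nonneg (by positivity)]
    · have h1 : 1 + SU * (2 * ((β ^ 2 - 1) / (SU + SL + 2 * β)) - β)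
          = -(tollDistortion SL SU β * (1 + SU * β)) := by
        rw [hE]
        field_simp
        linear_combination (-2 * β) * hnorm
      rw [h1, abs_neg, abs_of_nonneg (by positivity)]
    · rintro T hT
      obtain ⟨k₁, hk₁, k₂, hk₂, rfl⟩ := mem_affineTolls_iff.1 hT
      refine le_priceOfAnarchy_of_spread hSL hle hnorm hE0 hE1.le ?_
      rw [← hED]
      exact mul_le_mul_of_nonneg_left (by linarith [hk₁.2]) hE0

theorem optimal_affineSubsidies {β : ℝ} (hβ : 0 < β) :
    (∃ T, IsOptimalMechanism SL SU (affineSubsidies β) T) ∧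
      ∀ T, IsOptimalMechanism SL SU (affineSubsidies β) T →
        priceOfAnarchy SL SU T = ENNReal.ofReal (1 + subsidyDistortion SL SU β ^ 2 / 3) := by
  have hSU : 0 < SU := hSL.trans_le hle
  have hE0 := subsidyDistortion_nonneg hSL hle hβ
  have hE1 := subsidyDistortion_lt_one hSL hle hβ
  have hS : 0 < SU + SL := by positivity
  rcases le_or_gt (β * (SU + SL)) 1 with hβ1 | hβ1
  · have hE : subsidyDistortion SL SU β = 1 - 2 * SL * β := if_pos hβ1
    refine isOptimalMechanism_of_bounds (T₀ := affineMechanism 0 (-β))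
      (mem_affineSubsidies_iff.2 ⟨0, ⟨by linarith, le_rfl⟩, -β, ⟨le_rfl, by linarith⟩, rfl⟩)
      (priceOfAnarchy_affineMechanism_le_of_endpoints hE1 (by simp) (by simp) ?_ ?_) ?_
    · rw [hE, abs_le]
      constructor <;> nlinarith
    · rw [hE, abs_le]
      constructor <;> nlinarith
    · rintro T hT
      obtain ⟨k₁, hk₁, k₂, hk₂, rfl⟩ := mem_affineSubsidies_iff.1 hT
      refine le_priceOfAnarchy_affineMechanism ⟨le_rfl, hle⟩ hE0 hE1.le fun _ => ?_
      refine le_trans ?_ (le_abs_self _)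
      have h1 : subsidyDistortion SL SU β * (SL * -k₁) ≥ 0 :=
        mul_nonneg hE0 (mul_nonneg hSL.le (by linarith [hk₁.2]))
      have h2 : 0 ≤ SL * -k₁ := mul_nonneg hSL.le (by linarith [hk₁.2])
      have h3 : SL * -β ≤ SL * k₂ := mul_le_mul_of_nonneg_left hk₂.1 hSL.le
      nlinarith
  · have hE : subsidyDistortion SL SU β = (SU - SL) / (SU + SL) := if_neg hβ1.not_ge
    have hED : subsidyDistortion SL SU β * (SU + SL) = SU - SL := by
      rw [hE, div_mul_cancel₀ _ hS.ne']
    -- With `k₁ = 0`, this `k₂` gives `SL` and `SU` opposite signed distortions; a larger budget is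
    -- left unspent.
    refine isOptimalMechanism_of_bounds (T₀ := affineMechanism 0 (-(1 / (SU + SL))))
      (mem_affineSubsidies_iff.2 ⟨0, ⟨by linarith, le_rfl⟩, _,
        ⟨?_, neg_nonpos.2 (by positivity)⟩, rfl⟩)
      (priceOfAnarchy_affineMechanism_le_of_endpoints hE1 (by simp) (by simp) ?_ ?_) ?_
    · rw [neg_le_neg_iff, div_le_iff₀ hS]
      exact hβ1.le
    · have h1 : 1 + SL * (2 * (-(1 / (SU + SL))) - 0)
          = subsidyDistortion SL SU β * (1 + SL * 0) := by
        rw [hE]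
        field_simp; ring
      rw [h1, abs_of_nonneg (by simpa using hE0)]
    · have h1 : 1 + SU * (2 * (-(1 / (SU + SL))) - 0)
          = -(subsidyDistortion SL SU β * (1 + SU * 0)) := by
        rw [hE]
        field_simp; ring
      rw [h1, abs_neg, abs_of_nonneg (by simpa using hE0)]
    · rintro T hT
      obtain ⟨k₁, hk₁, k₂, hk₂, rfl⟩ := mem_affineSubsidies_iff.1 hT
      refine le_priceOfAnarchy_of_spread hSL hle hnorm hE0 hE1.le ?_
      rw [← hED]
      exact mul_le_mul_of_nonneg_left (by linarith [hk₁.2]) hE0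

/-! ### Comparison of the two distortions -/

/-- The subsidy saturates before the crossing point: `SL * (SU + SL) = 1 + SL² > 1`. -/
theorem subsidyDistortion_of_le {β : ℝ} (hβ : SL ≤ β) :
    subsidyDistortion SL SU β = (SU - SL) / (SU + SL) := by
  refine if_neg (not_le.2 ?_)
  nlinarith

theorem tollDistortion_self : tollDistortion SL SU SL = (SU - SL) / (SU + SL) := by
  have hSU : 0 < SU := hSL.trans_le hle
  rw [tollDistortion, if_pos (by nlinarith), div_eq_div_iff (by positivity) (by positivity)]
  linear_combination (-2 * SL) * hnorm

theorem subsidyDistortion_lt_tollDistortion {β : ℝ} (hβ : 0 < β) (hβSL : β < SL) :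
    subsidyDistortion SL SU β < tollDistortion SL SU β := by
  have hSU : 0 < SU := hSL.trans_le hle
  have hSL1 : SL ≤ 1 := by nlinarith
  have hSLβ := mul_pos hSL hβ
  rw [tollDistortion, if_pos (by linarith), subsidyDistortion]
  split_ifs with h
  · rw [lt_div_iff₀ (by positivity)]
    nlinarith
  · rw [div_lt_div_iff₀ (by positivity) (by positivity)]
    nlinarith

theorem tollDistortion_lt_subsidyDistortion {β : ℝ} (hβ : SL < β) (hlt : SL < SU) :
    tollDistortion SL SU β < subsidyDistortion SL SU β := by
  have hSU : 0 < SU := hSL.trans_le hle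
  have hβ0 : 0 < β := hSL.trans hβ
  have hSLβ := mul_pos hSL hβ0
  rw [subsidyDistortion_of_le hSL hle hnorm hβ.le, tollDistortion]
  split_ifs with h
  · rw [div_lt_div_iff₀ (by positivity) (by positivity)]
    nlinarith
  · exact div_lt_div_of_pos_left (by linarith) (by positivity) (by linarith)

theorem tollDistortion_le_subsidyDistortion {β : ℝ} (hβ : SL < β) :
    tollDistortion SL SU β ≤ subsidyDistortion SL SU β := by
  -- For equal sensitivities the normalization forces `SL = SU = 1`, and both distortions vanish.
  rcases hle.eq_or_lt with rfl | hlt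
  · have hSL1 : SL = 1 := by nlinarith
    subst hSL1
    rw [tollDistortion, if_neg hβ.not_ge, subsidyDistortion_of_le hSL hle hnorm hβ.le]
    simp
  · exact (tollDistortion_lt_subsidyDistortion hSL hle hnorm hβ hlt).le

end Distortion

theorem ofReal_distortion_lt {E E' : ℝ} (hE : 0 ≤ E) (h : E < E') :
    ENNReal.ofReal (1 + E ^ 2 / 3) < ENNReal.ofReal (1 + E' ^ 2 / 3) := by
  rw [ENNReal.ofReal_lt_ofReal_iff (by positivity)]
  nlinarith

theorem theorem5 (SL SU : ℝ) (hSL : 0 < SL) (hle : SL ≤ SU) (hnorm : SL * SU = 1) :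
    1 / SU = SL ∧
    ∀ β : ℝ, 0 < β →
      (∃ Tp, IsOptimalMechanism SL SU (affineTolls β) Tp) ∧
      (∃ Tm, IsOptimalMechanism SL SU (affineSubsidies β) Tm) ∧
      ∀ Tp Tm : Mechanism,
        IsOptimalMechanism SL SU (affineTolls β) Tp →
        IsOptimalMechanism SL SU (affineSubsidies β) Tm →
          (β = 1 / SU → priceOfAnarchy SL SU Tm = priceOfAnarchy SL SU Tp) ∧
          (β < 1 / SU → priceOfAnarchy SL SU Tm < priceOfAnarchy SL SU Tp) ∧
          (1 / SU < β → priceOfAnarchy SL SU Tp ≤ priceOfAnarchy SL SU Tm) ∧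
          (1 / SU < β → SL < SU → priceOfAnarchy SL SU Tp < priceOfAnarchy SL SU Tm) := by
  have hinv : 1 / SU = SL := by
    rw [div_eq_iff (hSL.trans_le hle).ne', hnorm]
  refine ⟨hinv, fun β hβ => ?_⟩
  obtain ⟨hTp, hpoaTp⟩ := optimal_affineTolls hSL hle hnorm hβ
  obtain ⟨hTm, hpoaTm⟩ := optimal_affineSubsidies hSL hle hnorm hβ
  refine ⟨hTp, hTm, fun Tp Tm hp hm => ?_⟩
  rw [hpoaTp Tp hp, hpoaTm Tm hm, hinv]
  have hp0 := tollDistortion_nonneg hSL hle hnorm hβ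
  have hm0 := subsidyDistortion_nonneg hSL hle hβ
  refine ⟨?_, fun h => ?_, fun h => ?_, fun h hlt => ?_⟩
  · rintro rfl
    rw [subsidyDistortion_of_le hSL hle hnorm le_rfl, tollDistortion_self hSL hle hnorm]
  · exact ofReal_distortion_lt hm0 (subsidyDistortion_lt_tollDistortion hSL hle hnorm hβ h)
  · have := pow_le_pow_left₀ hp0 (tollDistortion_le_subsidyDistortion hSL hle hnorm h) 2
    exact ENNReal.ofReal_le_ofReal (by linarith)
  · exact ofReal_distortion_lt hp0 (tollDistortion_lt_subsidyDistortion hSL hle hnorm h hlt)
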